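/- Let $n\ge 2$, let $\Omega\subset\mathbb{R}^n$ be a domain, and let $E\subset\Omega$ be closed in $\Omega$ with $\mathcal{H}^{n-1}(E)<+\infty$, where $\mathcal{H}^{n-1}$ is $(n-1)$-dimensional Hausdorff measure. For $1\le j\le n$ write points of $\mathbb{R}^n$ as $x=(x_j,X_j)$, where $X_j\in\mathbb{R}^{n-1}$ consists of the coordinates of $x$ other than $x_j$, and for $A\subset\mathbb{R}^n$ put $A(X_j)=\{x_j\in\mathbb{R}:(x_j,X_j)\in A\}$. Let $u:\Omega\setminus E\to\mathbb{R}$ be harmonic and such that the following conditions hold. (i) $u\in\mathcal{L}^1_{\mathrm{loc}}(\Omega)$. (ii) For each $j$, $1\le j\le n$, $\dfrac{\partial^2u}{\partial x_j^2}\in\mathcal{L}^1_{\mathrm{loc}}(\Omega)$. (iii) For each $j$, $1\le j\le n$, and for $\mathcal{H}^{n-1}$-almost all $X_j\in\mathbb{R}^{n-1}$ such that $E(X_j)$ is finite, the following holds: for each $x_j^0\in E(X_j)$ there exist sequences $x_{j,l}^{0,1},x_{j,l}^{0,2}\in(\Omega\setminus E)(X_j)$, $l=1,2,\dots$, such that $x_{j,l}^{0,1}\nearrow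 x_j^0$ and $x_{j,l}^{0,2}\searrow x_j^0$ as $l\to+\infty$, and (a) $\displaystyle\lim_{l\to+\infty}u(x_{j,l}^{0,1},X_j)=\lim_{l\to+\infty}u(x_{j,l}^{0,2},X_j)\in\mathbb{R}$, (b) $\displaystyle-\infty<\liminf_{l\to+\infty}\frac{\partial u}{\partial x_j}(x_{j,l}^{0,1},X_j)=\limsup_{l\to+\infty}\frac{\partial u}{\partial x_j}(x_{j,l}^{0,2},X_j)<+\infty$. Then $u$ has a unique harmonic extension to $\Omega$. -/

import Mathlib

open Set Filter Topology MeasureTheory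

namespace HarmonicExtension

noncomputable section

/-- The point `x = (x_j, X_j)` of `ℝⁿ` whose `j`-th coordinate is `t` and whose remaining
coordinates are given by `X`. -/
def coordPoint {n : ℕ} (j : Fin n) (t : ℝ) (X : EuclideanSpace ℝ {i : Fin n // i ≠ j}) :
    EuclideanSpace ℝ (Fin n) :=
  WithLp.toLp 2 fun i => if h : i = j then t else X ⟨i, h⟩

/-- The section `A(X_j) = {x_j ∈ ℝ : (x_j, X_j) ∈ A}` of `A ⊆ ℝⁿ` by the line through `X_j`
parallel to the `j`-th coordinate axis. -/
def lineSection {n : ℕ} (A : Set (EuclideanSpace ℝ (Fin n))) (j : Fin n)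
    (X : EuclideanSpace ℝ {i : Fin n // i ≠ j}) : Set ℝ :=
  {t : ℝ | coordPoint j t X ∈ A}

/-- The partial derivative `∂u/∂x_j`. -/
def partialDeriv {n : ℕ} (j : Fin n) (u : EuclideanSpace ℝ (Fin n) → ℝ) :
    EuclideanSpace ℝ (Fin n) → ℝ :=
  fun x => lineDeriv ℝ u x (EuclideanSpace.single j (1 : ℝ))

/-- The matching condition for `u` at the point `(t, X)` of `E`, in the direction `x_j`: there are
sequences in `(Ω \ E)(X)`, one increasing to `t` and one decreasing to `t`, along which `u` has the
same finite limit and along which the lower limit of `∂u/∂x_j` (from the left) and the upper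
limit of `∂u/∂x_j` (from the right), taken in the extended reals, are finite and equal. -/
def MatchesAt {n : ℕ} (Ω E : Set (EuclideanSpace ℝ (Fin n))) (u : EuclideanSpace ℝ (Fin n) → ℝ)
    (j : Fin n) (X : EuclideanSpace ℝ {i : Fin n // i ≠ j}) (t : ℝ) : Prop :=
  ∃ s₁ s₂ : ℕ → ℝ,
    (∀ l, s₁ l ∈ lineSection (Ω \ E) j X) ∧ (∀ l, s₂ l ∈ lineSection (Ω \ E) j X) ∧
    Monotone s₁ ∧ Tendsto s₁ atTop (𝓝 t) ∧ Antitone s₂ ∧ Tendsto s₂ atTop (𝓝 t) ∧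
    (∃ a : ℝ, Tendsto (fun l => u (coordPoint j (s₁ l) X)) atTop (𝓝 a) ∧
      Tendsto (fun l => u (coordPoint j (s₂ l) X)) atTop (𝓝 a)) ∧
    (∃ b : ℝ,
      liminf (fun l => ((partialDeriv j u (coordPoint j (s₁ l) X) : ℝ) : EReal)) atTop = b ∧
      limsup (fun l => ((partialDeriv j u (coordPoint j (s₂ l) X) : ℝ) : EReal)) atTop = b)

end

end HarmonicExtension

/-!
Since `E` has finite `(n - 1)`-dimensional measure, it meets almost every line parallel to a
coordinate axis in finitely many points. On such a line the integrability of `u''` forces one-sided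
limits of `u` and `u'` at these points, which the matching sequences then identify. Hence
integration by parts along the line produces no boundary terms, and Fubini's theorem gives
`∫ u Δφ = ∫ φ Δu = 0` for every test function `φ` on `Ω`, so `u` is weakly harmonic.

It remains to prove Weyl's lemma. Let `K` be a smooth probability density of the form
`K z = C * P' (‖z‖ ^ 2)`, where `P` vanishes on `[1, ∞)`, and let `K_c z = c ^ n * K (c z)`. The
derivative of `K_c` in `c` is a multiple of the Laplacian of the test function
`z ↦ P (c ^ 2 * ‖z‖ ^ 2)`, so `(u ⋆ K_c) x` does not depend on `c` once `c⁻¹` is less than the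
distance from `x` to the complement of `Ω`. This common value is a harmonic function of `x`, and it
is the limit of `(u ⋆ K_c) x` as `c → ∞`, which is `u x` for almost every `x`.
-/

namespace HarmonicExtension

open Measure InnerProductSpace Metric Module
open scoped ENNReal NNReal ContDiff Laplacian Convolution
open ContinuousLinearMap (lsmul lsmul_apply)

section OneVariable

variable {F : Type*} [NormedAddCommGroup F] [NormedSpace ℝ F]

theorem exists_continuousOn_Icc_eqOn_Ioo [CompleteSpace F] {a b : ℝ} (hab : a < b) {f : ℝ → F}
    (hf : ∀ t ∈ Ioo a b, DifferentiableAt ℝ f t) (hf' : IntegrableOn (deriv f) (Ioo a b)) :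
    ∃ g : ℝ → F, ContinuousOn g (Icc a b) ∧ EqOn f g (Ioo a b) := by
  obtain ⟨m, hm⟩ := nonempty_Ioo.2 hab
  have hint : IntervalIntegrable (deriv f) volume a b :=
    (intervalIntegrable_iff_integrableOn_Ioo_of_le hab.le).2 hf'
  refine ⟨fun s => f m + ∫ x in m..s, deriv f x, ?_, fun s hs => ?_⟩
  · rw [← uIcc_of_le hab.le]
    exact continuousOn_const.add (intervalIntegral.continuousOn_primitive_interval' hint
      (uIcc_of_le hab.le ▸ Ioo_subset_Icc_self hm))
  · have hsub : uIcc m s ⊆ Ioo a b := ordConnected_Ioo.uIcc_subset hm hs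
    have hms : uIcc m s ⊆ uIcc a b :=
      hsub.trans (Ioo_subset_Icc_self.trans Icc_subset_uIcc)
    simp only [intervalIntegral.integral_deriv_eq_sub (fun x hx => hf x (hsub hx))
      (hint.mono_set hms), add_sub_cancel]

theorem exists_tendsto_nhdsGT_of_integrableAtFilter_deriv [CompleteSpace F] {f : ℝ → F} {t : ℝ}
    (hf : ∀ᶠ s in 𝓝[>] t, DifferentiableAt ℝ f s) (hf' : IntegrableAtFilter (deriv f) (𝓝[>] t)) :
    ∃ p, Tendsto f (𝓝[>] t) (𝓝 p) := by
  obtain ⟨S, hS, hfS⟩ := hf'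
  obtain ⟨b, htb, hb⟩ := mem_nhdsGT_iff_exists_Ioo_subset.1 (inter_mem hf hS)
  obtain ⟨g, hg, hfg⟩ := exists_continuousOn_Icc_eqOn_Ioo htb (fun s hs => (hb hs).1)
    (hfS.mono_set fun s hs => (hb hs).2)
  refine ⟨g t, ?_⟩
  rw [← nhdsWithin_Ioo_eq_nhdsGT htb]
  exact ((hg t (left_mem_Icc.2 htb.le)).mono Ioo_subset_Icc_self).tendsto.congr'
    (hfg.symm.eventuallyEq_of_mem self_mem_nhdsWithin)

theorem exists_tendsto_nhdsLT_of_integrableAtFilter_deriv [CompleteSpace F] {f : ℝ → F} {t : ℝ}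
    (hf : ∀ᶠ s in 𝓝[<] t, DifferentiableAt ℝ f s) (hf' : IntegrableAtFilter (deriv f) (𝓝[<] t)) :
    ∃ p, Tendsto f (𝓝[<] t) (𝓝 p) := by
  obtain ⟨S, hS, hfS⟩ := hf'
  obtain ⟨a, hat, ha⟩ := mem_nhdsLT_iff_exists_Ioo_subset.1 (inter_mem hf hS)
  obtain ⟨g, hg, hfg⟩ := exists_continuousOn_Icc_eqOn_Ioo hat (fun s hs => (ha hs).1)
    (hfS.mono_set fun s hs => (ha hs).2)
  refine ⟨g t, ?_⟩
  rw [← nhdsWithin_Ioo_eq_nhdsLT hat]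
  exact ((hg t (right_mem_Icc.2 hat.le)).mono Ioo_subset_Icc_self).tendsto.congr'
    (hfg.symm.eventuallyEq_of_mem self_mem_nhdsWithin)

theorem integrableAtFilter_nhdsWithin_of_tendsto {f : ℝ → ℝ} {s : Set ℝ} {t p : ℝ}
    (hs : MeasurableSet s) (hf : Measurable f) (hp : Tendsto f (𝓝[s] t) (𝓝 p)) :
    IntegrableAtFilter f (𝓝[s] t) := by
  have := hs.nhdsWithin_isMeasurablyGenerated t
  exact (volume.finiteAt_nhdsWithin t s).integrableAtFilter_of_tendsto
    hf.stronglyMeasurable.stronglyMeasurableAtFilter hp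

/-- An integrable second derivative forces one-sided limits of `f` and `f'`, which the two sequences
then identify. -/
theorem tendsto_nhdsNE_and_deriv_of_seq {f : ℝ → ℝ} {t : ℝ}
    (hf : ∀ᶠ s in 𝓝[≠] t, DifferentiableAt ℝ f s)
    (hf' : ∀ᶠ s in 𝓝[≠] t, DifferentiableAt ℝ (deriv f) s)
    (hf'' : IntegrableAtFilter (deriv (deriv f)) (𝓝[≠] t)) {s₁ s₂ : ℕ → ℝ}
    (hs₁ : Tendsto s₁ atTop (𝓝[<] t)) (hs₂ : Tendsto s₂ atTop (𝓝[>] t)) {a b : ℝ}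
    (ha₁ : Tendsto (fun l => f (s₁ l)) atTop (𝓝 a))
    (ha₂ : Tendsto (fun l => f (s₂ l)) atTop (𝓝 a))
    (hb₁ : liminf (fun l => ((deriv f (s₁ l) : ℝ) : EReal)) atTop = b)
    (hb₂ : limsup (fun l => ((deriv f (s₂ l) : ℝ) : EReal)) atTop = b) :
    Tendsto f (𝓝[≠] t) (𝓝 a) ∧ Tendsto (deriv f) (𝓝[≠] t) (𝓝 b) := by
  rw [← nhdsLT_sup_nhdsGT] at hf hf' hf'' ⊢
  rw [eventually_sup] at hf hf'
  rw [IntegrableAtFilter.sup_iff] at hf''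
  obtain ⟨q₁, hq₁⟩ := exists_tendsto_nhdsLT_of_integrableAtFilter_deriv hf'.1 hf''.1
  obtain ⟨p₁, hp₁⟩ := exists_tendsto_nhdsGT_of_integrableAtFilter_deriv hf'.2 hf''.2
  obtain ⟨q, hq⟩ := exists_tendsto_nhdsLT_of_integrableAtFilter_deriv hf.1
    (integrableAtFilter_nhdsWithin_of_tendsto measurableSet_Iio (measurable_deriv f) hq₁)
  obtain ⟨p, hp⟩ := exists_tendsto_nhdsGT_of_integrableAtFilter_deriv hf.2
    (integrableAtFilter_nhdsWithin_of_tendsto measurableSet_Ioi (measurable_deriv f) hp₁)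
  have coe_tendsto : ∀ {s : ℕ → ℝ} {l : Filter ℝ} {r : ℝ}, Tendsto (deriv f) l (𝓝 r) →
      Tendsto s atTop l → Tendsto (fun i => ((deriv f (s i) : ℝ) : EReal)) atTop (𝓝 r) :=
    fun hr hs => (continuous_coe_real_ereal.tendsto _).comp (hr.comp hs)
  obtain rfl : q = a := tendsto_nhds_unique (hq.comp hs₁) ha₁
  obtain rfl : p = q := tendsto_nhds_unique (hp.comp hs₂) ha₂
  obtain rfl : q₁ = b := EReal.coe_injective ((coe_tendsto hq₁ hs₁).liminf_eq.symm.trans hb₁)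
  obtain rfl : p₁ = q₁ := EReal.coe_injective ((coe_tendsto hp₁ hs₂).limsup_eq.symm.trans hb₂)
  exact ⟨hq.sup hp, hq₁.sup hp₁⟩

theorem integral_deriv_eq_zero_of_differentiableAt_off_finite [CompleteSpace F] {w : ℝ → F}
    {S : Set ℝ} (hS : S.Finite) (hw : HasCompactSupport w)
    (hd : ∀ t ∉ S, DifferentiableAt ℝ w t) (hlim : ∀ t ∈ S, ∃ a, Tendsto w (𝓝[≠] t) (𝓝 a))
    (hi : Integrable (deriv w)) : ∫ t, deriv w t = 0 := by
  have hle : ∀ t ∈ S, 𝓝[Sᶜ] t ≤ 𝓝[≠] t := fun t ht => nhdsWithin_mono _ fun s hs h => hs (h ▸ ht)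
  have hdense : Dense Sᶜ := hS.countable.dense_compl ℝ
  have hoff : ∀ t ∉ S, Tendsto w (𝓝[Sᶜ] t) (𝓝 (w t)) := fun t ht =>
    (hd t ht).continuousAt.tendsto.mono_left nhdsWithin_le_nhds
  have hcont : Continuous (extendFrom Sᶜ w) := continuous_extendFrom hdense fun t => by
    by_cases ht : t ∈ S
    · exact (hlim t ht).imp fun a ha => ha.mono_left (hle t ht)
    · exact ⟨_, hoff t ht⟩
  have heq : EqOn (extendFrom Sᶜ w) w Sᶜ := fun t ht => extendFrom_eq (hdense t) (hoff t ht)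
  have hderiv : ∀ t ∉ S, HasDerivAt (extendFrom Sᶜ w) (deriv w t) t := fun t ht =>
    (hd t ht).hasDerivAt.congr_of_eventuallyEq
      (heq.eventuallyEq_of_mem (hS.isClosed.isOpen_compl.mem_nhds ht))
  obtain ⟨R, hR0, hR⟩ := (hw.isCompact.union hS.isCompact).isBounded.subset_ball_lt 0 0
  have hout : ∀ t, R ≤ |t| → t ∉ tsupport w ∧ t ∉ S := fun t ht => by
    rw [← not_or, ← mem_union]
    exact fun h => (mem_ball_zero_iff.1 (hR h)).not_ge ht
  have hzero : ∀ t, R ≤ |t| → extendFrom Sᶜ w t = 0 := fun t ht => by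
    rw [heq (hout t ht).2, image_eq_zero_of_notMem_tsupport (hout t ht).1]
  have hsupp : ∀ t ∉ Ioc (-R) R, deriv w t = 0 := fun t ht => by
    refine image_eq_zero_of_notMem_tsupport fun h => ?_
    refine (hout t ?_).1 (tsupport_deriv_subset h)
    by_contra! hlt
    exact ht ⟨(abs_lt.1 hlt).1, (abs_lt.1 hlt).2.le⟩
  rw [← setIntegral_eq_integral_of_forall_compl_eq_zero hsupp,
    ← intervalIntegral.integral_of_le (by linarith),
    integral_eq_of_hasDerivAt_off_countable (extendFrom Sᶜ w) (deriv w) hS.countable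
      hcont.continuousOn (fun t ht => hderiv t ht.2) hi.intervalIntegrable,
    hzero R (le_abs_self R), hzero (-R) (by rw [abs_neg]; exact le_abs_self R), sub_zero]

/-- Green's identity in one variable; the boundary terms at the points of `S` cancel because `f` and
`f'` have two-sided limits there. -/
theorem integral_mul_deriv_deriv_eq_of_finite {f φ : ℝ → ℝ} {S O : Set ℝ} (hS : S.Finite)
    (hφ : ContDiff ℝ 2 φ) (hφc : HasCompactSupport φ) (hφO : tsupport φ ⊆ O)
    (hf : ∀ t ∈ O \ S, DifferentiableAt ℝ f t) (hf' : ∀ t ∈ O \ S, DifferentiableAt ℝ (deriv f) t)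
    (hlim : ∀ t ∈ O ∩ S, ∃ a b, Tendsto f (𝓝[≠] t) (𝓝 a) ∧ Tendsto (deriv f) (𝓝[≠] t) (𝓝 b))
    (hi : Integrable fun t => f t * deriv (deriv φ) t)
    (hi' : Integrable fun t => deriv (deriv f) t * φ t) :
    ∫ t, f t * deriv (deriv φ) t = ∫ t, deriv (deriv f) t * φ t := by
  set w : ℝ → ℝ := fun t => f t * deriv φ t - deriv f t * φ t with hw
  have hdφ : Differentiable ℝ φ := hφ.differentiable two_ne_zero
  have hdφ' : Differentiable ℝ (deriv φ) := hφ.differentiable_deriv_two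
  have hoff : ∀ t ∉ tsupport φ, w =ᶠ[𝓝 t] 0 := fun t ht => by
    have hev := notMem_tsupport_iff_eventuallyEq.1 ht
    filter_upwards [hev, hev.deriv] with s h0 h1
    simp [hw, h0, h1]
  have hd : ∀ t ∉ S, HasDerivAt w (f t * deriv (deriv φ) t - deriv (deriv f) t * φ t) t := by
    intro t ht
    by_cases htφ : t ∈ tsupport φ
    · have htO : t ∈ O \ S := ⟨hφO htφ, ht⟩
      exact (((hf t htO).hasDerivAt.mul (hdφ' t).hasDerivAt).sub
        ((hf' t htO).hasDerivAt.mul (hdφ t).hasDerivAt)).congr_deriv (by ring)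
    · have hev := notMem_tsupport_iff_eventuallyEq.1 htφ
      have h2 : deriv (deriv φ) t = 0 := by simpa using hev.deriv.deriv.eq_of_nhds
      rw [h2, hev.eq_of_nhds]
      simpa using (hasDerivAt_const t (0 : ℝ)).congr_of_eventuallyEq (hoff t htφ)
  have hwc : HasCompactSupport w := hφc.of_isClosed_subset (isClosed_tsupport _) fun t ht => by
    by_contra h
    exact notMem_tsupport_iff_eventuallyEq.2 (hoff t h) ht
  have hwlim : ∀ t ∈ S, ∃ a, Tendsto w (𝓝[≠] t) (𝓝 a) := fun t ht => by
    by_cases htφ : t ∈ tsupport φ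
    · obtain ⟨a, b, ha, hb⟩ := hlim t ⟨hφO htφ, ht⟩
      exact ⟨_, (ha.mul ((hdφ' t).continuousAt.tendsto.mono_left nhdsWithin_le_nhds)).sub
        (hb.mul ((hdφ t).continuousAt.tendsto.mono_left nhdsWithin_le_nhds))⟩
    · exact ⟨0, (tendsto_const_nhds.congr' (hoff t htφ).symm).mono_left nhdsWithin_le_nhds⟩
  have hae : deriv w =ᵐ[volume] fun t => f t * deriv (deriv φ) t - deriv (deriv f) t * φ t := by
    filter_upwards [hS.countable.ae_notMem volume] with t ht using (hd t ht).deriv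
  rw [← sub_eq_zero, ← integral_sub hi hi', ← integral_congr_ae hae]
  exact integral_deriv_eq_zero_of_differentiableAt_off_finite hS hwc
    (fun t ht => (hd t ht).differentiableAt) hwlim ((hi.sub hi').congr hae.symm)

end OneVariable

section FiniteFibers

variable {X Y : Type*} [EMetricSpace Y] [MeasurableSpace Y] [BorelSpace Y]

/-- The number of cells `{h = i}` of a partition of `E` that are met by the fiber of `π` over `y`.
The image of each cell is replaced by a measurable hull, so the count is measurable in `y` but exact
only almost everywhere. -/
noncomputable def fiberCellCount (d : ℝ) (π : X → Y) (E : Set X) (h : X → ℤ) (y : Y) : ℝ≥0∞ :=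
  ∑' i, (toMeasurable μH[d] (π '' (E ∩ h ⁻¹' {i}))).indicator 1 y

theorem measurable_fiberCellCount (d : ℝ) (π : X → Y) (E : Set X) (h : X → ℤ) :
    Measurable (fiberCellCount d π E h) :=
  Measurable.tsum fun _ => measurable_one.indicator (measurableSet_toMeasurable _ _)

theorem card_le_fiberCellCount (d : ℝ) (π : X → Y) (E : Set X) {g : X → ℝ} {f : ℝ → ℤ} {y : Y}
    {A : Finset ℝ} (hA : (A : Set ℝ) ⊆ g '' (E ∩ π ⁻¹' {y})) (hf : InjOn f A) :
    (A.card : ℝ≥0∞) ≤ fiberCellCount d π E (f ∘ g) y := by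
  calc (A.card : ℝ≥0∞) = ∑ _i ∈ A.image f, 1 := by simp [Finset.card_image_of_injOn hf]
    _ = ∑ i ∈ A.image f,
          (toMeasurable μH[d] (π '' (E ∩ (f ∘ g) ⁻¹' {i}))).indicator 1 y := by
        refine Finset.sum_congr rfl fun i hi => ?_
        obtain ⟨t, ht, rfl⟩ := Finset.mem_image.1 hi
        obtain ⟨x, ⟨hxE, hxy⟩, rfl⟩ := hA ht
        have hy : y ∈ π '' (E ∩ (f ∘ g) ⁻¹' {f (g x)}) := ⟨x, ⟨hxE, rfl⟩, hxy⟩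
        rw [indicator_of_mem (subset_toMeasurable _ _ hy), Pi.one_apply]
    _ ≤ _ := ENNReal.sum_le_tsum _

variable [EMetricSpace X] [MeasurableSpace X] [BorelSpace X]

theorem lintegral_fiberCellCount_le {d : ℝ} (hd : 0 ≤ d) {π : X → Y} {K : ℝ≥0}
    (hπ : LipschitzWith K π) (E : Set X) {h : X → ℤ} (hh : Measurable h) :
    ∫⁻ y, fiberCellCount d π E h y ∂μH[d] ≤ K ^ d * μH[d] E := by
  have hcell : ∀ i, MeasurableSet (h ⁻¹' {i}) := fun i => hh (measurableSet_singleton i)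
  calc ∫⁻ y, fiberCellCount d π E h y ∂μH[d]
      = ∑' i, μH[d] (π '' (E ∩ h ⁻¹' {i})) := by
        simp only [fiberCellCount]
        rw [lintegral_tsum fun i =>
          (measurable_one.indicator (measurableSet_toMeasurable _ _)).aemeasurable]
        simp only [lintegral_indicator_one (measurableSet_toMeasurable _ _), measure_toMeasurable]
    _ ≤ ∑' i, K ^ d * μH[d] (E ∩ h ⁻¹' {i}) :=
        ENNReal.tsum_le_tsum fun i => hπ.hausdorffMeasure_image_le hd _
    _ = K ^ d * ∑' i, μH[d].restrict E (h ⁻¹' {i}) := by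
        simp only [ENNReal.tsum_mul_left, restrict_apply (hcell _), inter_comm E]
    _ = K ^ d * μH[d] E := by
        rw [← measure_iUnion (fun i k hik => (disjoint_singleton.2 hik).preimage h) hcell,
          ← preimage_iUnion, iUnion_of_singleton, preimage_univ, restrict_apply_univ]

theorem eventually_injOn_floor_natCast_mul (A : Finset ℝ) :
    ∀ᶠ m : ℕ in atTop, InjOn (fun t : ℝ => ⌊(m : ℝ) * t⌋) A := by
  have : ∀ᶠ m : ℕ in atTop, ∀ s ∈ A, ∀ t ∈ A, s ≠ t → 1 ≤ m * |s - t| := by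
    simp only [Filter.eventually_all_finset]
    intro s _ t _
    rw [eventually_imp_distrib_left]
    exact fun hst => (tendsto_natCast_atTop_atTop.atTop_mul_const
      (abs_pos.2 (sub_ne_zero.2 hst))).eventually_ge_atTop 1
  filter_upwards [this] with m hm s hs t ht hfl
  by_contra hst
  have hlt := Int.abs_sub_lt_one_of_floor_eq_floor hfl
  rw [← mul_sub, abs_mul, Nat.abs_cast] at hlt
  exact (hm s hs t ht hst).not_gt hlt

/-- By Fatou, the cell counts for the partitions `⌊m g⌋ = i` stay bounded for almost every `y` along
a sequence of `m`, while they would exceed any bound if the fiber took infinitely many values. -/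
theorem ae_finite_image_inter_fiber {d : ℝ} (hd : 0 ≤ d) {π : X → Y} {K : ℝ≥0}
    (hπ : LipschitzWith K π) {E : Set X} (hE : μH[d] E < ⊤) {g : X → ℝ} (hg : Measurable g) :
    ∀ᵐ y ∂μH[d], (g '' (E ∩ π ⁻¹' {y})).Finite := by
  let N : ℕ → Y → ℝ≥0∞ := fun m => fiberCellCount d π E ((fun t : ℝ => ⌊(m : ℝ) * t⌋) ∘ g)
  have hN : ∀ m, Measurable (N m) := fun m => measurable_fiberCellCount _ _ _ _
  have hint : ∫⁻ y, liminf (fun m => N m y) atTop ∂μH[d] < ⊤ :=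
    calc ∫⁻ y, liminf (fun m => N m y) atTop ∂μH[d]
        ≤ liminf (fun m => ∫⁻ y, N m y ∂μH[d]) atTop := lintegral_liminf_le hN
      _ ≤ liminf (fun _ => K ^ d * μH[d] E) atTop := liminf_le_liminf (.of_forall fun m =>
          lintegral_fiberCellCount_le hd hπ E
            ((Int.measurable_floor.comp (measurable_const_mul (m : ℝ))).comp hg))
      _ = K ^ d * μH[d] E := liminf_const _
      _ < ⊤ := ENNReal.mul_lt_top (ENNReal.rpow_lt_top_of_nonneg hd ENNReal.coe_ne_top) hE
  filter_upwards [ae_lt_top (.liminf hN) hint.ne] with y hy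
  by_contra hinf
  refine hy.ne (ENNReal.eq_top_of_forall_nnreal_le fun r => ?_)
  obtain ⟨k, hk⟩ := exists_nat_ge r
  obtain ⟨A, hA, rfl⟩ := Set.Infinite.exists_subset_card_eq hinf k
  refine le_liminf_of_le (by isBoundedDefault) ?_
  filter_upwards [eventually_injOn_floor_natCast_mul A] with m hm
  calc (r : ℝ≥0∞) ≤ A.card := by exact_mod_cast hk
    _ ≤ N m y := card_le_fiberCellCount d π E hA hm

end FiniteFibers

theorem absolutelyContinuous_hausdorffMeasure_finrank {V : Type*} [NormedAddCommGroup V]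
    [NormedSpace ℝ V] [FiniteDimensional ℝ V] [MeasurableSpace V] [BorelSpace V] (μ : Measure V)
    [IsAddHaarMeasure μ] : μ ≪ μH[Module.finrank ℝ V] :=
  have := isAddHaarMeasure_hausdorffMeasure (E := V)
  absolutelyContinuous_isAddHaarMeasure _ _

section Slicing

variable {n : ℕ} (j : Fin n)

theorem coordPoint_add (t s : ℝ) (X : EuclideanSpace ℝ {i : Fin n // i ≠ j}) :
    coordPoint j (t + s) X = coordPoint j t X + s • EuclideanSpace.single j (1 : ℝ) := by
  ext i
  by_cases h : i = j
  · subst h; simp [coordPoint]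
  · simp [coordPoint, h]

theorem coordPoint_apply_self (t : ℝ) (X : EuclideanSpace ℝ {i : Fin n // i ≠ j}) :
    coordPoint j t X j = t := by
  simp [coordPoint]

theorem contDiff_coordPoint {m : WithTop ℕ∞} (X : EuclideanSpace ℝ {i : Fin n // i ≠ j}) :
    ContDiff ℝ m fun t => coordPoint j t X := by
  have : (fun t => coordPoint j t X) =
      fun t => coordPoint j 0 X + t • EuclideanSpace.single j (1 : ℝ) := by
    ext1 t
    rw [← coordPoint_add, zero_add]
  rw [this]
  fun_prop

theorem isClosedEmbedding_coordPoint (X : EuclideanSpace ℝ {i : Fin n // i ≠ j}) :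
    IsClosedEmbedding fun t => coordPoint j t X :=
  Function.LeftInverse.isClosedEmbedding (f := fun x : EuclideanSpace ℝ (Fin n) => x j)
    (fun t => coordPoint_apply_self j t X) (by fun_prop)
    (contDiff_coordPoint (m := 0) j X).continuous

theorem deriv_comp_coordPoint (f : EuclideanSpace ℝ (Fin n) → ℝ)
    (X : EuclideanSpace ℝ {i : Fin n // i ≠ j}) :
    deriv (fun s => f (coordPoint j s X)) = fun t => partialDeriv j f (coordPoint j t X) := by
  ext t
  simp only [partialDeriv, lineDeriv, ← coordPoint_add]
  rw [deriv_comp_const_add (fun s => f (coordPoint j s X)) t 0, add_zero]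

/-- The measurable isomorphism `(t, X) ↦ coordPoint j t X`, through which integrals over `ℝⁿ` are
sliced along the `j`-th axis. -/
noncomputable def coordEquiv :
    ℝ × EuclideanSpace ℝ {i : Fin n // i ≠ j} ≃ᵐ EuclideanSpace ℝ (Fin n) :=
  ((MeasurableEquiv.prodCongr (MeasurableEquiv.funUnique {i : Fin n // i = j} ℝ).symm
    (MeasurableEquiv.toLp 2 ({i : Fin n // i ≠ j} → ℝ)).symm).trans
    (MeasurableEquiv.piEquivPiSubtypeProd (fun _ : Fin n => ℝ) (· = j)).symm).trans
    (MeasurableEquiv.toLp 2 (Fin n → ℝ))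

theorem measurePreserving_coordEquiv :
    MeasurePreserving (coordEquiv j) (volume.prod volume) volume := by
  have hline := (volume_preserving_funUnique {i : Fin n // i = j} ℝ).symm
  have hcompl := EuclideanSpace.volume_preserving_symm_measurableEquiv_toLp {i : Fin n // i ≠ j}
  have hsplit : MeasurePreserving
      (MeasurableEquiv.piEquivPiSubtypeProd (fun _ : Fin n => ℝ) (· = j)).symm
      (((volume : Measure ({i : Fin n // i = j} → ℝ))).prod
        (volume : Measure ({i : Fin n // i ≠ j} → ℝ))) volume := by
    convert (volume_preserving_piEquivPiSubtypeProd (fun _ : Fin n => ℝ) (· = j)).symm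
    · rfl
    · rw [Measure.volume_eq_prod]
      congr!
  exact (EuclideanSpace.volume_preserving_symm_measurableEquiv_toLp (Fin n)).symm.comp
    (hsplit.comp (hline.prod hcompl))

theorem integral_eq_integral_integral_coordPoint {f : EuclideanSpace ℝ (Fin n) → ℝ}
    (hf : Integrable f) : ∫ x, f x = ∫ X, ∫ t, f (coordPoint j t X) := by
  have hp := measurePreserving_coordEquiv j
  rw [← hp.integral_comp (coordEquiv j).measurableEmbedding]
  exact integral_prod_symm (fun p => f (coordEquiv j p))
    ((hp.integrable_comp_emb (coordEquiv j).measurableEmbedding).2 hf)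

theorem ae_integrable_coordPoint {f : EuclideanSpace ℝ (Fin n) → ℝ} (hf : Integrable f) :
    ∀ᵐ X, Integrable fun t => f (coordPoint j t X) :=
  Integrable.prod_left_ae (((measurePreserving_coordEquiv j).integrable_comp_emb
    (coordEquiv j).measurableEmbedding).2 hf)

theorem measurableSet_lineSection {A : Set (EuclideanSpace ℝ (Fin n))} (hA : MeasurableSet A)
    (X : EuclideanSpace ℝ {i : Fin n // i ≠ j}) : MeasurableSet (lineSection A j X) :=
  (isClosedEmbedding_coordPoint j X).continuous.measurable hA

theorem ae_integrableOn_lineSection {f : EuclideanSpace ℝ (Fin n) → ℝ}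
    {A : Set (EuclideanSpace ℝ (Fin n))} (hA : MeasurableSet A) (hf : IntegrableOn f A) :
    ∀ᵐ X, IntegrableOn (fun t => f (coordPoint j t X)) (lineSection A j X) := by
  filter_upwards [ae_integrable_coordPoint j (hf.integrable_indicator hA)] with X hX
  exact (integrable_indicator_iff (measurableSet_lineSection j hA X)).1 hX

theorem volume_eq_lintegral_volume_lineSection {A : Set (EuclideanSpace ℝ (Fin n))}
    (hA : MeasurableSet A) : volume A = ∫⁻ X, volume (lineSection A j X) := by
  rw [← (measurePreserving_coordEquiv j).measure_preimage hA.nullMeasurableSet,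
    prod_apply_symm ((coordEquiv j).measurable hA)]
  rfl

/-- The projection of `ℝⁿ` that drops the `j`-th coordinate, so that `lineSection A j X` is the set
of `j`-th coordinates of the points of `A` lying over `X`. -/
noncomputable def forget (x : EuclideanSpace ℝ (Fin n)) : EuclideanSpace ℝ {i : Fin n // i ≠ j} :=
  WithLp.toLp 2 fun i => x i

theorem forget_coordPoint (t : ℝ) (X : EuclideanSpace ℝ {i : Fin n // i ≠ j}) :
    forget j (coordPoint j t X) = X := by
  ext i
  simp [forget, coordPoint, i.2]

theorem lipschitzWith_forget : LipschitzWith 1 (forget j) := by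
  refine LipschitzWith.of_dist_le_mul fun x y => ?_
  rw [NNReal.coe_one, one_mul, EuclideanSpace.dist_eq, EuclideanSpace.dist_eq]
  refine Real.sqrt_le_sqrt ?_
  calc ∑ i : {i // i ≠ j}, dist (x i) (y i) ^ 2
      = ∑ i ∈ Finset.univ.filter (· ≠ j), dist (x i) (y i) ^ 2 :=
        (Finset.sum_subtype _ (by simp) fun i => dist (x i) (y i) ^ 2).symm
    _ ≤ _ := Finset.sum_le_sum_of_subset_of_nonneg (Finset.filter_subset _ _)
        fun _ _ _ => by positivity

theorem lineSection_subset_image_inter_forget (A : Set (EuclideanSpace ℝ (Fin n)))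
    (X : EuclideanSpace ℝ {i : Fin n // i ≠ j}) :
    lineSection A j X ⊆ (· j) '' (A ∩ forget j ⁻¹' {X}) := fun t ht =>
  ⟨coordPoint j t X, ⟨ht, forget_coordPoint j t X⟩, coordPoint_apply_self j t X⟩

theorem ae_finite_lineSection {d : ℝ} (hd : 0 ≤ d) {E : Set (EuclideanSpace ℝ (Fin n))}
    (hE : μH[d] E < ⊤) : ∀ᵐ X ∂μH[d], (lineSection E j X).Finite := by
  filter_upwards [ae_finite_image_inter_fiber hd (lipschitzWith_forget j) hE
    (by fun_prop : Measurable fun x : EuclideanSpace ℝ (Fin n) => x j)] with X hX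
  exact hX.subset (lineSection_subset_image_inter_forget j E X)

theorem volume_absolutelyContinuous_hausdorffMeasure :
    (volume : Measure (EuclideanSpace ℝ {i : Fin n // i ≠ j})) ≪ μH[n - 1] := by
  simpa [Nat.cast_sub j.pos] using
    absolutelyContinuous_hausdorffMeasure_finrank
      (volume : Measure (EuclideanSpace ℝ {i : Fin n // i ≠ j}))

end Slicing

section LineDerivatives

variable {V W : Type*} [NormedAddCommGroup V] [NormedSpace ℝ V] [NormedAddCommGroup W]
  [NormedSpace ℝ W]

theorem contDiff_lineDeriv {m : ℕ∞} {f : V → W} (hf : ContDiff ℝ (m + 1) f) (v : V) :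
    ContDiff ℝ m fun x => lineDeriv ℝ f x v := by
  have hdiff : Differentiable ℝ f := hf.differentiable (by simp)
  simp only [(hdiff _).lineDeriv_eq_fderiv]
  exact (hf.fderiv_right le_rfl).clm_apply contDiff_const

theorem tsupport_lineDeriv_subset (f : V → W) (v : V) :
    tsupport (fun x => lineDeriv ℝ f x v) ⊆ tsupport f := by
  refine closure_minimal (fun x hx => ?_) (isClosed_tsupport f)
  by_contra h
  exact hx ((notMem_tsupport_iff_eventuallyEq.1 h).lineDeriv_eq.trans (by simp [lineDeriv]))

theorem hasCompactSupport_lineDeriv {f : V → W} (hf : HasCompactSupport f) (v : V) :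
    HasCompactSupport fun x => lineDeriv ℝ f x v :=
  hf.of_isClosed_subset (isClosed_tsupport _) (tsupport_lineDeriv_subset f v)

end LineDerivatives

theorem laplacian_eq_sum_lineDeriv_lineDeriv {V W ι : Type*} [NormedAddCommGroup V]
    [InnerProductSpace ℝ V] [FiniteDimensional ℝ V] [NormedAddCommGroup W] [NormedSpace ℝ W]
    [Fintype ι] (b : OrthonormalBasis ι ℝ V) {f : V → W} {x : V} (hf : ContDiffAt ℝ 2 f x) :
    Δ f x = ∑ i, lineDeriv ℝ (fun y => lineDeriv ℝ f y (b i)) x (b i) := by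
  have hdiff : DifferentiableAt ℝ (fderiv ℝ f) x :=
    (hf.fderiv_right (m := 1) (by norm_num)).differentiableAt one_ne_zero
  have hline : ∀ v, (fun y => lineDeriv ℝ f y v) =ᶠ[𝓝 x] fun y => fderiv ℝ f y v := fun v => by
    filter_upwards [hf.eventually (by simp)] with y hy
    exact (hy.differentiableAt two_ne_zero).lineDeriv_eq_fderiv
  rw [laplacian_eq_iteratedFDeriv_orthonormalBasis f b]
  refine Finset.sum_congr rfl fun i _ => ?_
  rw [iteratedFDeriv_two_apply, (hline (b i)).lineDeriv_eq,
    (hdiff.clm_apply (differentiableAt_const (b i))).lineDeriv_eq_fderiv,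
    fderiv_clm_apply hdiff (differentiableAt_const (b i))]
  simp

theorem integrable_mul_of_tsupport_subset {X : Type*} [TopologicalSpace X] [T2Space X]
    [MeasurableSpace X] [OpensMeasurableSpace X] {μ : Measure X} {Ω : Set X} {f φ : X → ℝ}
    (hf : LocallyIntegrableOn f Ω μ) (hφ : Continuous φ) (hφc : HasCompactSupport φ)
    (hφΩ : tsupport φ ⊆ Ω) : Integrable (fun x => f x * φ x) μ := by
  have h := (hf.integrableOn_compact_subset hφΩ hφc).mul_continuousOn hφ.continuousOn hφc
  exact (integrableOn_iff_integrable_of_support_subset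
    ((Function.support_mul_subset_right f φ).trans (subset_tsupport φ))).1 h

/-- Harmonicity of `f` on `Ω` in the sense of distributions: `f` is orthogonal to the Laplacian of
every test function on `Ω`. As the integral of a non-integrable function is `0`, the notion is
meaningful only for `f` locally integrable on `Ω`. -/
def IsWeaklyHarmonicOn {V : Type*} [NormedAddCommGroup V] [InnerProductSpace ℝ V]
    [FiniteDimensional ℝ V] [MeasurableSpace V] (f : V → ℝ) (Ω : Set V) (μ : Measure V) : Prop :=
  ∀ φ : V → ℝ, ContDiff ℝ ∞ φ → HasCompactSupport φ → tsupport φ ⊆ Ω → ∫ x, f x * Δ φ x ∂μ = 0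

section SlicedGreen

variable {n : ℕ} {j : Fin n} {Ω E : Set (EuclideanSpace ℝ (Fin n))}
  {u φ : EuclideanSpace ℝ (Fin n) → ℝ}

theorem deriv_deriv_comp_coordPoint (j : Fin n) (f : EuclideanSpace ℝ (Fin n) → ℝ)
    (X : EuclideanSpace ℝ {i : Fin n // i ≠ j}) :
    deriv (deriv fun s => f (coordPoint j s X)) =
      fun t => partialDeriv j (partialDeriv j f) (coordPoint j t X) := by
  rw [deriv_comp_coordPoint, deriv_comp_coordPoint]

theorem ae_locallyIntegrableOn_lineSection (j : Fin n) (hΩ : IsOpen Ω)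
    (hu : LocallyIntegrableOn u Ω) :
    ∀ᵐ X, LocallyIntegrableOn (fun t => u (coordPoint j t X)) (lineSection Ω j X) := by
  obtain ⟨v, hv, hΩv, huv⟩ := hu.exists_nat_integrableOn
  filter_upwards [ae_all_iff.2 fun i =>
    ae_integrableOn_lineSection j ((hv i).inter hΩ).measurableSet (huv i)] with X hX t ht
  obtain ⟨i, hi⟩ := mem_iUnion.1 (hΩv ht)
  exact ⟨_, mem_nhdsWithin_of_mem_nhds ((((hv i).inter hΩ).preimage
    (isClosedEmbedding_coordPoint j X).continuous).mem_nhds ⟨hi, ht⟩), hX i⟩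

theorem volume_eq_zero_of_ae_finite_lineSection (j : Fin n) (hE : MeasurableSet E)
    (hfin : ∀ᵐ X, (lineSection E j X).Finite) : volume E = 0 := by
  rw [volume_eq_lintegral_volume_lineSection j hE, lintegral_congr_ae
    (hfin.mono fun X hX => hX.measure_zero volume), lintegral_zero]

theorem MatchesAt.exists_tendsto {X : EuclideanSpace ℝ {i : Fin n // i ≠ j}} {t : ℝ}
    (hmatch : MatchesAt Ω E u j X t) (hΩ : IsOpen Ω) (hu : ∀ x ∈ Ω \ E, ContDiffAt ℝ 2 u x)
    (hfin : (lineSection E j X).Finite) (htΩ : t ∈ lineSection Ω j X) (htE : t ∈ lineSection E j X)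
    (hint : IntegrableAtFilter
      (fun s => partialDeriv j (partialDeriv j u) (coordPoint j s X)) (𝓝 t)) :
    ∃ a b, Tendsto (fun s => u (coordPoint j s X)) (𝓝[≠] t) (𝓝 a) ∧
      Tendsto (deriv fun s => u (coordPoint j s X)) (𝓝[≠] t) (𝓝 b) := by
  obtain ⟨s₁, s₂, hs₁, hs₂, hmono, hlim₁, hanti, hlim₂, ⟨a, ha₁, ha₂⟩, b, hb₁, hb₂⟩ := hmatch
  have hslice : ∀ᶠ s in 𝓝[≠] t, ContDiffAt ℝ 2 (fun s => u (coordPoint j s X)) s := by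
    have hΩt := (hΩ.preimage (isClosedEmbedding_coordPoint j X).continuous).mem_nhds htΩ
    have hEt := (hfin.subset (sdiff_subset (t := {t}))).isClosed.isOpen_compl.mem_nhds
      (fun h => h.2 rfl)
    filter_upwards [mem_nhdsWithin_of_mem_nhds hΩt, mem_nhdsWithin_of_mem_nhds hEt,
      self_mem_nhdsWithin] with s hsΩ hsE hst
    exact (hu _ ⟨hsΩ, fun h => hsE ⟨h, hst⟩⟩).comp s (contDiff_coordPoint j X).contDiffAt
  have hlt : ∀ l, s₁ l < t := fun l =>
    (hmono.ge_of_tendsto hlim₁ l).lt_of_ne fun h => (hs₁ l).2 (h ▸ htE)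
  have hgt : ∀ l, t < s₂ l := fun l =>
    (hanti.le_of_tendsto hlim₂ l).lt_of_ne' fun h => (hs₂ l).2 (h ▸ htE)
  refine ⟨a, b, tendsto_nhdsNE_and_deriv_of_seq
    (hslice.mono fun s hs => hs.differentiableAt two_ne_zero)
    (hslice.mono fun s hs => (hs.derivWithin (m := 1) (by norm_num)).differentiableAt one_ne_zero)
    ?_ (tendsto_nhdsWithin_iff.2 ⟨hlim₁, .of_forall hlt⟩)
    (tendsto_nhdsWithin_iff.2 ⟨hlim₂, .of_forall hgt⟩) ha₁ ha₂ ?_ ?_⟩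
  · rw [deriv_deriv_comp_coordPoint]
    exact hint.filter_mono nhdsWithin_le_nhds
  · simpa only [deriv_comp_coordPoint] using hb₁
  · simpa only [deriv_comp_coordPoint] using hb₂

theorem integral_slice_mul_partialDeriv_eq {X : EuclideanSpace ℝ {i : Fin n // i ≠ j}}
    (hΩ : IsOpen Ω) (hu : ∀ x ∈ Ω \ E, ContDiffAt ℝ 2 u x)
    (hfin : (lineSection E j X).Finite)
    (hmatch : ∀ t ∈ lineSection E j X, MatchesAt Ω E u j X t)
    (hloc : LocallyIntegrableOn (fun t => partialDeriv j (partialDeriv j u) (coordPoint j t X))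
      (lineSection Ω j X))
    (hφ : ContDiff ℝ 2 φ) (hφc : HasCompactSupport φ) (hφΩ : tsupport φ ⊆ Ω)
    (hint : Integrable fun t =>
      u (coordPoint j t X) * partialDeriv j (partialDeriv j φ) (coordPoint j t X))
    (hint' : Integrable fun t =>
      partialDeriv j (partialDeriv j u) (coordPoint j t X) * φ (coordPoint j t X)) :
    ∫ t, u (coordPoint j t X) * partialDeriv j (partialDeriv j φ) (coordPoint j t X) =
      ∫ t, partialDeriv j (partialDeriv j u) (coordPoint j t X) * φ (coordPoint j t X) := by
  have hemb := isClosedEmbedding_coordPoint j X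
  have hΩX : IsOpen (lineSection Ω j X) := hΩ.preimage hemb.continuous
  have hslice : ∀ t ∈ lineSection Ω j X \ lineSection E j X,
      ContDiffAt ℝ 2 (fun s => u (coordPoint j s X)) t := fun t ht =>
    (hu _ ht).comp t (contDiff_coordPoint j X).contDiffAt
  have key := integral_mul_deriv_deriv_eq_of_finite (f := fun t => u (coordPoint j t X))
    (φ := fun t => φ (coordPoint j t X)) (O := lineSection Ω j X) hfin
    (hφ.comp (contDiff_coordPoint j X)) (hφc.comp_isClosedEmbedding hemb)
    ((tsupport_comp_subset_preimage φ hemb.continuous).trans (preimage_mono hφΩ))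
    (fun t ht => (hslice t ht).differentiableAt two_ne_zero)
    (fun t ht => ((hslice t ht).derivWithin (m := 1) (by norm_num)).differentiableAt one_ne_zero)
    (fun t ht => (hmatch t ht.2).exists_tendsto hΩ hu hfin ht.1 ht.2
      (hΩX.nhdsWithin_eq ht.1 ▸ hloc t ht.1))
  simp only [deriv_deriv_comp_coordPoint] at key
  exact key hint hint'

theorem integrable_mul_partialDeriv_partialDeriv (j : Fin n) (hu : LocallyIntegrableOn u Ω)
    (hφ : ContDiff ℝ 2 φ) (hφc : HasCompactSupport φ) (hφΩ : tsupport φ ⊆ Ω) :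
    Integrable fun x => u x * partialDeriv j (partialDeriv j φ) x :=
  integrable_mul_of_tsupport_subset hu
    (contDiff_lineDeriv (m := 0) (contDiff_lineDeriv (m := 1) hφ _) _).continuous
    (hasCompactSupport_lineDeriv (hasCompactSupport_lineDeriv hφc _) _)
    ((tsupport_lineDeriv_subset _ _).trans ((tsupport_lineDeriv_subset _ _).trans hφΩ))

theorem integral_mul_partialDeriv_partialDeriv_eq (hΩ : IsOpen Ω)
    (hu : ∀ x ∈ Ω \ E, ContDiffAt ℝ 2 u x) (hu_int : LocallyIntegrableOn u Ω)
    (hu_int2 : LocallyIntegrableOn (partialDeriv j (partialDeriv j u)) Ω)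
    (hfin : ∀ᵐ X, (lineSection E j X).Finite)
    (hmatch : ∀ᵐ X : EuclideanSpace ℝ {i : Fin n // i ≠ j},
      ∀ t ∈ lineSection E j X, MatchesAt Ω E u j X t)
    (hφ : ContDiff ℝ 2 φ) (hφc : HasCompactSupport φ) (hφΩ : tsupport φ ⊆ Ω) :
    ∫ x, u x * partialDeriv j (partialDeriv j φ) x =
      ∫ x, partialDeriv j (partialDeriv j u) x * φ x := by
  have hint := integrable_mul_partialDeriv_partialDeriv j hu_int hφ hφc hφΩ
  have hint' := integrable_mul_of_tsupport_subset hu_int2 hφ.continuous hφc hφΩ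
  rw [integral_eq_integral_integral_coordPoint j hint,
    integral_eq_integral_integral_coordPoint j hint']
  refine integral_congr_ae ?_
  filter_upwards [hfin, hmatch, ae_locallyIntegrableOn_lineSection j hΩ hu_int2,
    ae_integrable_coordPoint j hint, ae_integrable_coordPoint j hint'] with X hX hmX hlX hiX hiX'
  exact integral_slice_mul_partialDeriv_eq hΩ hu hX hmX hlX hφ hφc hφΩ hiX hiX'

theorem isWeaklyHarmonicOn_of_matchesAt (hΩ : IsOpen Ω) (hEΩ : volume (Ω ∩ E) = 0)
    (hu : HarmonicOnNhd u (Ω \ E)) (hu_int : LocallyIntegrableOn u Ω)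
    (hu_int2 : ∀ j, LocallyIntegrableOn (partialDeriv j (partialDeriv j u)) Ω)
    (hfin : ∀ j, ∀ᵐ X, (lineSection E j X).Finite)
    (hmatch : ∀ j, ∀ᵐ X : EuclideanSpace ℝ {i : Fin n // i ≠ j},
      ∀ t ∈ lineSection E j X, MatchesAt Ω E u j X t) :
    IsWeaklyHarmonicOn u Ω volume := by
  intro φ hφ hφc hφΩ
  have hφ2 : ContDiff ℝ 2 φ := contDiff_infty.1 hφ 2
  have hΔ : ∀ {f : EuclideanSpace ℝ (Fin n) → ℝ} {x}, ContDiffAt ℝ 2 f x →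
      Δ f x = ∑ j, partialDeriv j (partialDeriv j f) x := fun hf => by
    simpa only [EuclideanSpace.basisFun_apply] using!
      laplacian_eq_sum_lineDeriv_lineDeriv (EuclideanSpace.basisFun (Fin n) ℝ) hf
  calc ∫ x, u x * Δ φ x = ∑ j, ∫ x, u x * partialDeriv j (partialDeriv j φ) x := by
        simp only [hΔ hφ2.contDiffAt, Finset.mul_sum]
        exact integral_finsetSum _ fun j _ =>
          integrable_mul_partialDeriv_partialDeriv j hu_int hφ2 hφc hφΩ
    _ = ∑ j, ∫ x, partialDeriv j (partialDeriv j u) x * φ x :=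
        Finset.sum_congr rfl fun j _ => integral_mul_partialDeriv_partialDeriv_eq hΩ
          (fun x hx => (hu x hx).1) hu_int (hu_int2 j) (hfin j) (hmatch j) hφ2 hφc hφΩ
    _ = ∫ x, (∑ j, partialDeriv j (partialDeriv j u) x) * φ x := by
        simp only [Finset.sum_mul]
        exact (integral_finsetSum _ fun j _ =>
          integrable_mul_of_tsupport_subset (hu_int2 j) hφ.continuous hφc hφΩ).symm
    _ = 0 := integral_eq_zero_of_ae ?_
  filter_upwards [compl_mem_ae_iff.2 hEΩ] with x hx
  by_cases hxΩ : x ∈ Ω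
  · have hux := hu x ⟨hxΩ, fun h => hx ⟨hxΩ, h⟩⟩
    rw [← hΔ hux.1, hux.2.eq_of_nhds, Pi.zero_apply, zero_mul]
  · rw [image_eq_zero_of_notMem_tsupport fun h => hxΩ (hφΩ h), mul_zero, Pi.zero_apply]

end SlicedGreen

section Laplacians

theorem lineDeriv_comp_const_sub {V W : Type*} [NormedAddCommGroup V] [NormedSpace ℝ V]
    [NormedAddCommGroup W] [NormedSpace ℝ W] (f : V → W) (a x v : V) :
    lineDeriv ℝ (fun y => f (a - y)) x v = -lineDeriv ℝ f (a - x) v := by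
  rw [← lineDeriv_neg]
  simp only [lineDeriv, smul_neg, ← sub_sub, ← sub_eq_add_neg]

variable {V W : Type*} [NormedAddCommGroup V] [InnerProductSpace ℝ V] [FiniteDimensional ℝ V]
  [NormedAddCommGroup W] [NormedSpace ℝ W]

theorem laplacian_eq_zero_of_notMem_tsupport {f : V → W} {x : V} (hx : x ∉ tsupport f) :
    Δ f x = 0 := by
  rw [(laplacian_congr_nhds (notMem_tsupport_iff_eventuallyEq.1 hx)).eq_of_nhds]
  exact congrFun laplacian_const x

theorem laplacian_comp_const_sub {f : V → W} (hf : ContDiff ℝ 2 f) (a x : V) :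
    Δ (fun y : V => f (a - y)) x = Δ f (a - x) := by
  have hfa : ContDiff ℝ 2 fun y => f (a - y) := hf.comp (contDiff_const.sub contDiff_id)
  rw [laplacian_eq_sum_lineDeriv_lineDeriv (stdOrthonormalBasis ℝ V) hf.contDiffAt,
    laplacian_eq_sum_lineDeriv_lineDeriv (stdOrthonormalBasis ℝ V) hfa.contDiffAt]
  refine Finset.sum_congr rfl fun i _ => ?_
  set v := stdOrthonormalBasis ℝ V i
  calc lineDeriv ℝ (fun y => lineDeriv ℝ (fun z => f (a - z)) y v) x v
      = lineDeriv ℝ (fun y => lineDeriv ℝ f (a - y) (-v)) x v := by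
        simp only [lineDeriv_comp_const_sub, lineDeriv_neg]
    _ = -lineDeriv ℝ (fun y => lineDeriv ℝ f y (-v)) (a - x) v :=
        lineDeriv_comp_const_sub (fun z => lineDeriv ℝ f z (-v)) a x v
    _ = lineDeriv ℝ (fun y => lineDeriv ℝ f y v) (a - x) v := by
        simp only [lineDeriv_neg]
        rw [lineDeriv, deriv.fun_neg, neg_neg, lineDeriv]

theorem laplacian_comp_const_mul_norm_sq {P : ℝ → ℝ} (hP : ContDiff ℝ 2 P) (a : ℝ) (x : V) :
    Δ (fun y : V => P (a * ‖y‖ ^ 2)) x = 4 * a ^ 2 * ‖x‖ ^ 2 * deriv (deriv P) (a * ‖x‖ ^ 2) +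
      2 * a * finrank ℝ V * deriv P (a * ‖x‖ ^ 2) := by
  set b := stdOrthonormalBasis ℝ V
  have hP' : Differentiable ℝ (deriv P) :=
    ((contDiff_succ_iff_deriv (n := 1)).1 hP).2.2.differentiable one_ne_zero
  have hnorm : ∀ y : V, HasFDerivAt (fun y => a * ‖y‖ ^ 2) (a • 2 • innerSL ℝ y) y := fun y =>
    (hasStrictFDerivAt_norm_sq y).hasFDerivAt.const_mul a
  have hline : ∀ y v : V,
      lineDeriv ℝ (fun y => P (a * ‖y‖ ^ 2)) y v = deriv P (a * ‖y‖ ^ 2) * (2 * a * inner ℝ v y) :=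
    fun y v => by
      have h := (hP.differentiable two_ne_zero _).hasDerivAt.comp_hasFDerivAt y (hnorm y)
      refine (h.hasLineDerivAt v).lineDeriv.trans ?_
      simp only [_root_.smul_apply, coe_innerSL_apply, nsmul_eq_mul, Nat.cast_ofNat, smul_eq_mul,
        real_inner_comm y v]
      ring
  have hline' : ∀ v : V, ‖v‖ = 1 →
      lineDeriv ℝ (fun y => deriv P (a * ‖y‖ ^ 2) * (2 * a * inner ℝ v y)) x v =
        4 * a ^ 2 * deriv (deriv P) (a * ‖x‖ ^ 2) * inner ℝ v x ^ 2 +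
          2 * a * deriv P (a * ‖x‖ ^ 2) := fun v hv => by
    have h := ((hP' _).hasDerivAt.comp_hasFDerivAt x (hnorm x)).mul
      ((innerSL ℝ v).hasFDerivAt.const_mul (2 * a))
    refine (h.hasLineDerivAt v).lineDeriv.trans ?_
    simp only [Function.comp_apply, coe_innerSL_apply, real_inner_comm x v, _root_.add_apply,
      _root_.smul_apply, real_inner_self_eq_norm_sq, hv, one_pow, smul_eq_mul, mul_one,
      nsmul_eq_mul, Nat.cast_ofNat]
    ring
  have hsmooth : ContDiff ℝ 2 fun y : V => P (a * ‖y‖ ^ 2) :=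
    hP.comp (contDiff_const.mul (contDiff_norm_sq ℝ))
  rw [laplacian_eq_sum_lineDeriv_lineDeriv b hsmooth.contDiffAt]
  simp only [hline]
  rw [Finset.sum_congr rfl fun i _ => hline' (b i) (b.norm_eq_one i), Finset.sum_add_distrib,
    ← Finset.mul_sum, b.sum_sq_inner_right]
  simp only [Finset.sum_const, Finset.card_univ, Fintype.card_fin, nsmul_eq_mul]
  ring

end Laplacians

section Convolutions

variable {V E F G : Type*} [NormedAddCommGroup V] [MeasurableSpace V] [BorelSpace V]
  [NormedAddCommGroup E] [NormedSpace ℝ E] [NormedAddCommGroup F] [NormedSpace ℝ F]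
  [NormedAddCommGroup G] [NormedSpace ℝ G] {μ : Measure V} {f : V → E}

theorem lineDeriv_convolution_right [NormedSpace ℝ V] [SFinite μ] [IsAddLeftInvariant μ]
    (L : E →L[ℝ] F →L[ℝ] G) {g : V → F} (hf : LocallyIntegrable f μ) (hg : ContDiff ℝ 1 g)
    (hgc : HasCompactSupport g) (x v : V) :
    lineDeriv ℝ (f ⋆[L, μ] g) x v = (f ⋆[L, μ] fun y => lineDeriv ℝ g y v) x := by
  rw [((hgc.hasFDerivAt_convolution_right L hf hg x).hasLineDerivAt v).lineDeriv,
    convolution_precompR_apply L hf (hgc.fderiv ℝ) (hg.continuous_fderiv one_ne_zero)]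
  simp only [((hg.differentiable one_ne_zero) _).lineDeriv_eq_fderiv]

theorem hasDerivAt_convolution_right_with_param [NormedSpace ℝ V] (L : E →L[ℝ] F →L[ℝ] G)
    {g : ℝ → V → F} {s : Set ℝ} {k : Set V} (hs : IsOpen s) (hk : IsCompact k)
    (hgs : ∀ p, ∀ x, p ∈ s → x ∉ k → g p x = 0) (hf : LocallyIntegrable f μ)
    (hg : ContDiffOn ℝ 1 ↿g (s ×ˢ (univ : Set V))) {p : ℝ} (hp : p ∈ s) (x : V) :
    HasDerivAt (fun q => (f ⋆[L, μ] g q) x)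
      ((f ⋆[L, μ] fun y => deriv (fun q => g q y) p) x) p := by
  have hnhds : ∀ y, s ×ˢ (univ : Set V) ∈ 𝓝 (p, y) := fun y =>
    (hs.prod isOpen_univ).mem_nhds ⟨hp, mem_univ y⟩
  have hsupp : HasCompactSupport fun y => fderiv ℝ ↿g (p, y) := .intro hk fun y hy => by
    have h : ↿g =ᶠ[𝓝 (p, y)] fun _ => 0 := by
      filter_upwards [(hs.prod hk.isClosed.isOpen_compl).mem_nhds ⟨hp, hy⟩] with q hq
      exact hgs _ _ hq.1 hq.2
    rw [h.fderiv_eq, fderiv_const_apply]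
  have hcont : Continuous fun y => fderiv ℝ ↿g (p, y) :=
    (hg.continuousOn_fderiv_of_isOpen (hs.prod isOpen_univ) le_rfl).comp_continuous
      (.prodMk_right p) fun y => ⟨hp, mem_univ y⟩
  have key := (hasFDerivAt_convolution_right_with_param L hs hk hgs hf hg (p, x) hp).comp_hasDerivAt
    p ((hasDerivAt_id p).prodMk (hasDerivAt_const p x))
  rw [convolution_precompR_apply L hf hsupp hcont] at key
  refine key.congr_deriv ?_
  congr 1
  ext y
  have hgy := ((hg.contDiffAt (hnhds y)).differentiableAt one_ne_zero).hasFDerivAt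
  exact (hgy.comp_hasDerivAt p ((hasDerivAt_id p).prodMk (hasDerivAt_const p y))).deriv.symm

variable [InnerProductSpace ℝ V] [FiniteDimensional ℝ V] [SFinite μ] [IsAddLeftInvariant μ]

theorem laplacian_convolution_right (L : E →L[ℝ] F →L[ℝ] G) {g : V → F}
    (hf : LocallyIntegrable f μ) (hg : ContDiff ℝ 2 g) (hgc : HasCompactSupport g) :
    Δ (f ⋆[L, μ] g) = f ⋆[L, μ] Δ g := by
  ext x
  set b := stdOrthonormalBasis ℝ V
  have hg1 : ContDiff ℝ 1 g := hg.of_le one_le_two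
  have hg' : ∀ v, ContDiff ℝ 1 fun y => lineDeriv ℝ g y v := fun v =>
    contDiff_lineDeriv (m := 1) hg v
  have hgc' : ∀ v, HasCompactSupport fun y => lineDeriv ℝ g y v := hasCompactSupport_lineDeriv hgc
  have hex : ∀ v, ConvolutionExistsAt f
      (fun y => lineDeriv ℝ (fun z => lineDeriv ℝ g z v) y v) x L μ := fun v =>
    (hasCompactSupport_lineDeriv (hgc' v) v).convolutionExists_right L hf
      (contDiff_lineDeriv (m := 0) (hg' v) v).continuous x
  rw [laplacian_eq_sum_lineDeriv_lineDeriv b (hgc.contDiff_convolution_right L hf hg).contDiffAt]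
  simp only [lineDeriv_convolution_right L hf hg1 hgc,
    fun v => lineDeriv_convolution_right L hf (hg' v) (hgc' v)]
  simp only [convolution_def, laplacian_eq_sum_lineDeriv_lineDeriv b hg.contDiffAt, _root_.map_sum]
  exact (integral_finsetSum _ fun i _ => hex (b i)).symm

end Convolutions

section Dilations

variable {V : Type*} [NormedAddCommGroup V] [NormedSpace ℝ V]

/-- The `L¹`-normalised dilates `z ↦ cⁿ g (c z)` of a function on an `n`-dimensional space. They
concentrate at the origin as `c → ∞`, so `c⁻¹` plays the role of a mollification radius. -/
noncomputable def dilate (g : V → ℝ) (c : ℝ) (z : V) : ℝ := c ^ finrank ℝ V * g (c • z)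

theorem support_dilate_subset {g : V → ℝ} (hg : Function.support g ⊆ closedBall 0 1) {c : ℝ}
    (hc : 0 < c) : Function.support (dilate g c) ⊆ closedBall 0 c⁻¹ := fun z hz => by
  have h : c * ‖z‖ ≤ 1 := by
    simpa [norm_smul, abs_of_pos hc] using hg (right_ne_zero_of_mul hz)
  rwa [mem_closedBall_zero_iff, ← one_div, le_div_iff₀' hc]

variable [FiniteDimensional ℝ V] [MeasurableSpace V] [BorelSpace V] {μ : Measure V}
  [μ.IsAddHaarMeasure]

theorem integral_dilate (g : V → ℝ) {c : ℝ} (hc : 0 < c) :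
    ∫ z, dilate g c z ∂μ = ∫ z, g z ∂μ := by
  simp only [dilate]
  rw [integral_const_mul, integral_comp_smul_of_nonneg μ g c (hR := hc.le), smul_eq_mul,
    mul_inv_cancel_left₀ (by positivity)]

theorem ae_tendsto_convolution_dilate {f g : V → ℝ} {M : ℝ} (hf : LocallyIntegrable f μ)
    (hgM : ∀ z, |g z| ≤ M) (hg : Function.support g ⊆ closedBall 0 1) (hg1 : ∫ z, g z ∂μ = 1) :
    ∀ᵐ x ∂μ, Tendsto (fun c => (f ⋆[lsmul ℝ ℝ, μ] dilate g c) x) atTop (𝓝 (f x)) := by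
  filter_upwards [(Besicovitch.vitaliFamily μ).ae_tendsto_average_norm_sub hf] with x hx
  have havg := (hx.comp (Besicovitch.tendsto_filterAt μ x)).comp tendsto_inv_atTop_nhdsGT_zero
  have key := tendsto_integral_smul_of_tendsto_average_norm_sub
    (g := fun c y => dilate g c (x - y)) (M * μ.real (closedBall 0 1)) havg
    (.of_forall fun c => hf.integrableOn_isCompact (isCompact_closedBall _ _)) ?_ ?_ ?_
  · refine key.congr fun c => ?_
    simp only [convolution_def, lsmul_apply, smul_eq_mul, mul_comm]
  · refine tendsto_const_nhds.congr' ?_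
    filter_upwards [eventually_gt_atTop 0] with c hc
    rw [integral_sub_left_eq_self (dilate g c) μ x, integral_dilate g hc, hg1]
  · filter_upwards [eventually_gt_atTop 0] with c hc y hy
    have h := support_dilate_subset hg hc hy
    rwa [mem_closedBall_zero_iff, ← dist_eq_norm_sub, ← mem_closedBall'] at h
  · filter_upwards [eventually_gt_atTop 0] with c hc y
    have hball : μ.real (closedBall x c⁻¹) = (c ^ finrank ℝ V)⁻¹ * μ.real (closedBall 0 1) := by
      rw [addHaar_real_closedBall' μ x (by positivity), inv_pow]
    have hpos : 0 < μ.real (closedBall (0 : V) 1) :=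
      ENNReal.toReal_pos (measure_closedBall_pos μ 0 one_pos).ne' measure_closedBall_lt_top.ne
    calc |dilate g c (x - y)| = c ^ finrank ℝ V * |g (c • (x - y))| := by
          rw [dilate, abs_mul, abs_of_pos (by positivity)]
      _ ≤ c ^ finrank ℝ V * M := by gcongr; exact hgM _
      _ = M * μ.real (closedBall 0 1) / μ.real (closedBall x c⁻¹) := by
          rw [hball]
          field_simp

end Dilations

section RadialBump

/-- A smooth function on the line which vanishes on `[1, ∞)` and has nonnegative derivative. The
dilates of the radial function `z ↦ P' (‖z‖ ^ 2)` form the mollifier `radialBump`, and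
`radialPotential` is this `P`. -/
noncomputable def radialPotential (t : ℝ) : ℝ := -expNegInvGlue (1 - t)

theorem contDiff_radialPotential : ContDiff ℝ ∞ radialPotential :=
  (expNegInvGlue.contDiff.comp (contDiff_const.sub contDiff_id)).neg

theorem radialPotential_of_one_le {t : ℝ} (ht : 1 ≤ t) : radialPotential t = 0 := by
  rw [radialPotential, expNegInvGlue.zero_of_nonpos (by linarith), neg_zero]

theorem contDiff_deriv_radialPotential : ContDiff ℝ ∞ (deriv radialPotential) :=
  (contDiff_infty_iff_deriv.1 contDiff_radialPotential).2

theorem deriv_radialPotential (t : ℝ) :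
    deriv radialPotential t = (1 - t)⁻¹ ^ 2 * expNegInvGlue (1 - t) := by
  have h : HasDerivAt expNegInvGlue ((1 - t)⁻¹ ^ 2 * expNegInvGlue (1 - t)) (1 - t) := by
    simpa using expNegInvGlue.hasDerivAt_polynomial_eval_inv_mul 1 (1 - t)
  exact (h.comp_const_sub 1 t).neg.deriv.trans (neg_neg _)

theorem deriv_radialPotential_of_one_le {t : ℝ} (ht : 1 ≤ t) : deriv radialPotential t = 0 := by
  rw [deriv_radialPotential, expNegInvGlue.zero_of_nonpos (by linarith), mul_zero]

theorem deriv_radialPotential_nonneg (t : ℝ) : 0 ≤ deriv radialPotential t := by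
  rw [deriv_radialPotential]
  exact mul_nonneg (sq_nonneg _) (expNegInvGlue.nonneg _)

theorem deriv_radialPotential_zero_pos : 0 < deriv radialPotential 0 := by
  rw [deriv_radialPotential]
  exact mul_pos (by norm_num) (expNegInvGlue.pos_of_pos (by norm_num))

theorem support_comp_mul_norm_sq_subset {V : Type*} [SeminormedAddCommGroup V] {P : ℝ → ℝ}
    (hP : ∀ t, 1 ≤ t → P t = 0) {c : ℝ} (hc : 0 < c) :
    Function.support (fun z : V => P (c ^ 2 * ‖z‖ ^ 2)) ⊆ closedBall 0 c⁻¹ := fun z hz => by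
  have h : (c * ‖z‖) ^ 2 < 1 := by
    rw [mul_pow]
    exact lt_of_not_ge fun h => hz (hP _ h)
  rw [sq_lt_one_iff₀ (by positivity)] at h
  rw [mem_closedBall_zero_iff, ← one_div, le_div_iff₀' hc]
  exact h.le

variable {V : Type*} [NormedAddCommGroup V] [MeasurableSpace V] {μ : Measure V}

/-- The smooth radial probability density proportional to `P' (‖z‖ ^ 2)`, where `P` is
`radialPotential`. -/
noncomputable def radialBump (μ : Measure V) (z : V) : ℝ :=
  (∫ w : V, deriv radialPotential (‖w‖ ^ 2) ∂μ)⁻¹ * deriv radialPotential (‖z‖ ^ 2)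

theorem support_radialBump_subset : Function.support (radialBump μ) ⊆ closedBall 0 1 := by
  refine (Function.support_mul_subset_right _ _).trans ?_
  simpa only [one_pow, one_mul, inv_one] using support_comp_mul_norm_sq_subset (V := V)
    (fun _ => deriv_radialPotential_of_one_le) one_pos

variable [InnerProductSpace ℝ V]

theorem contDiff_radialBump : ContDiff ℝ ∞ (radialBump μ) :=
  contDiff_const.mul (contDiff_deriv_radialPotential.comp (contDiff_norm_sq ℝ))

theorem contDiff_dilate_radialBump : ContDiff ℝ ∞ ↿(dilate (radialBump μ)) :=
  (contDiff_fst.pow _).mul (contDiff_radialBump.comp (contDiff_fst.smul contDiff_snd))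

variable [FiniteDimensional ℝ V]

theorem hasCompactSupport_radialBump : HasCompactSupport (radialBump μ) :=
  .of_support_subset_isCompact (isCompact_closedBall 0 1) support_radialBump_subset

theorem integral_radialBump [BorelSpace V] [IsFiniteMeasureOnCompacts μ] [μ.IsOpenPosMeasure] :
    ∫ z, radialBump μ z ∂μ = 1 := by
  have hcont : Continuous fun z : V => deriv radialPotential (‖z‖ ^ 2) :=
    contDiff_deriv_radialPotential.continuous.comp (by fun_prop)
  have hsupp : HasCompactSupport fun z : V => deriv radialPotential (‖z‖ ^ 2) :=
    .of_support_subset_isCompact (isCompact_closedBall 0 1) (by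
      simpa only [one_pow, one_mul, inv_one] using support_comp_mul_norm_sq_subset (V := V)
        (fun _ => deriv_radialPotential_of_one_le) one_pos)
  have hpos : 0 < ∫ z : V, deriv radialPotential (‖z‖ ^ 2) ∂μ :=
    hcont.integral_pos_of_hasCompactSupport_nonneg_nonzero hsupp
      (fun z => deriv_radialPotential_nonneg _) (x := 0)
      (by simpa using deriv_radialPotential_zero_pos.ne')
  simp only [radialBump]
  rw [integral_const_mul, inv_mul_cancel₀ hpos.ne']

/- The identity behind Weyl's lemma: changing the scale of the mollifier changes it by the
Laplacian of a test function. -/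
theorem deriv_dilate_radialBump {c : ℝ} (hc : c ≠ 0) :
    (fun z => deriv (fun a => dilate (radialBump μ) a z) c) =
      ((∫ w : V, deriv radialPotential (‖w‖ ^ 2) ∂μ)⁻¹ * (c ^ finrank ℝ V / (2 * c ^ 3))) •
        Δ (fun w : V => radialPotential (c ^ 2 * ‖w‖ ^ 2)) := by
  ext z
  have hP' : HasDerivAt (deriv radialPotential)
      (deriv (deriv radialPotential) (c ^ 2 * ‖z‖ ^ 2)) (c ^ 2 * ‖z‖ ^ 2) :=
    (contDiff_deriv_radialPotential.differentiable (by simp) _).hasDerivAt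
  have hsq : HasDerivAt (fun a : ℝ => a ^ 2 * ‖z‖ ^ 2) (2 * c * ‖z‖ ^ 2) c := by
    simpa using (hasDerivAt_pow 2 c).mul_const (‖z‖ ^ 2)
  have h := ((hasDerivAt_pow (finrank ℝ V) c).mul (hP'.comp c hsq)).const_mul
    (∫ w : V, deriv radialPotential (‖w‖ ^ 2) ∂μ)⁻¹
  have heq : (fun a => dilate (radialBump μ) a z) = fun a =>
      (∫ w : V, deriv radialPotential (‖w‖ ^ 2) ∂μ)⁻¹ *
        (a ^ finrank ℝ V * deriv radialPotential (a ^ 2 * ‖z‖ ^ 2)) := by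
    ext a
    rw [dilate, radialBump, norm_smul, mul_pow, Real.norm_eq_abs, sq_abs, mul_left_comm]
  have hpow : (finrank ℝ V : ℝ) * c ^ (finrank ℝ V - 1) = finrank ℝ V * c ^ finrank ℝ V / c := by
    rcases finrank ℝ V with _ | n
    · simp
    · rw [Nat.add_sub_cancel, pow_succ]
      field_simp
  rw [heq, Pi.smul_apply, smul_eq_mul,
    laplacian_comp_const_mul_norm_sq (contDiff_infty.1 contDiff_radialPotential 2)]
  refine h.deriv.trans ?_
  rw [hpow, Function.comp_apply]
  field_simp
  ring

end RadialBump

section WeylLemma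

variable {V : Type*} [NormedAddCommGroup V] [InnerProductSpace ℝ V] [FiniteDimensional ℝ V]
  [MeasurableSpace V] {μ : Measure V} {f φ : V → ℝ} {Ω O : Set V} {x : V} {r : ℝ}

theorem IsWeaklyHarmonicOn.indicator (hf : IsWeaklyHarmonicOn f Ω μ) (hO : O ⊆ Ω) :
    IsWeaklyHarmonicOn (O.indicator f) O μ := fun φ hφ hφc hφO => by
  rw [← hf φ hφ hφc (hφO.trans hO)]
  refine integral_congr_ae (.of_forall fun x => ?_)
  by_cases hx : x ∈ O
  · simp only [indicator_of_mem hx]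
  · simp only [laplacian_eq_zero_of_notMem_tsupport fun h => hx (hφO h), mul_zero]

theorem IsWeaklyHarmonicOn.convolution_laplacian_eq_zero (hf : IsWeaklyHarmonicOn f Ω μ)
    (hφ : ContDiff ℝ ∞ φ) (hφc : HasCompactSupport φ) (hx : ∀ y ∈ tsupport φ, x - y ∈ Ω) :
    (f ⋆[lsmul ℝ ℝ, μ] Δ φ) x = 0 := by
  have hsupp : tsupport (fun y => φ (x - y)) ⊆ Ω := fun y hy => by
    have h := hx (x - y) (tsupport_comp_subset_preimage φ (continuous_const.sub continuous_id) hy)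
    rwa [sub_sub_cancel] at h
  rw [← hf (fun y => φ (x - y)) (hφ.comp (contDiff_const.sub contDiff_id))
    (hφc.comp_homeomorph (Homeomorph.subLeft x)) hsupp]
  simp only [convolution_def, lsmul_apply, smul_eq_mul,
    laplacian_comp_const_sub (contDiff_infty.1 hφ 2)]

variable [BorelSpace V]

theorem IsWeaklyHarmonicOn.hasDerivAt_convolution_dilate_radialBump
    (hf : IsWeaklyHarmonicOn f Ω μ) (hfi : LocallyIntegrable f μ) (hr : 0 < r)
    (hx : closedBall x r ⊆ Ω) {c : ℝ} (hc : r⁻¹ < c) :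
    HasDerivAt (fun q => (f ⋆[lsmul ℝ ℝ, μ] dilate (radialBump μ) q) x) 0 c := by
  have hpos : ∀ q ∈ Ioi r⁻¹, 0 < q := fun q hq => (inv_pos.2 hr).trans hq
  have hball : ∀ q ∈ Ioi r⁻¹, closedBall (0 : V) q⁻¹ ⊆ closedBall 0 r := fun q hq =>
    closedBall_subset_closedBall (inv_le_of_inv_le₀ hr (mem_Ioi.1 hq).le)
  have hbump : ∀ q, ∀ z : V, q ∈ Ioi r⁻¹ → z ∉ closedBall 0 r → dilate (radialBump μ) q z = 0 :=
    fun q z hq hz => by_contra fun h =>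
      hz (hball q hq (support_dilate_subset support_radialBump_subset (hpos q hq) h))
  refine (hasDerivAt_convolution_right_with_param (lsmul ℝ ℝ) isOpen_Ioi
    (isCompact_closedBall 0 r) hbump hfi (contDiff_dilate_radialBump.of_le (by simp)).contDiffOn
    hc x).congr_deriv ?_
  have hP : Function.support (fun z : V => radialPotential (c ^ 2 * ‖z‖ ^ 2)) ⊆ closedBall 0 r :=
    (support_comp_mul_norm_sq_subset (fun _ => radialPotential_of_one_le) (hpos c hc)).trans
      (hball c hc)
  rw [deriv_dilate_radialBump (hpos c hc).ne', convolution_smul, Pi.smul_apply,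
    hf.convolution_laplacian_eq_zero, smul_zero]
  · exact contDiff_radialPotential.comp (contDiff_const.mul (contDiff_norm_sq ℝ))
  · exact .of_support_subset_isCompact (isCompact_closedBall 0 r) hP
  · exact fun y hy => hx (by simpa using closure_minimal hP isClosed_closedBall hy)

theorem IsWeaklyHarmonicOn.convolution_dilate_radialBump_eq (hf : IsWeaklyHarmonicOn f Ω μ)
    (hfi : LocallyIntegrable f μ) (hr : 0 < r) (hx : closedBall x r ⊆ Ω) {a b : ℝ}
    (ha : r⁻¹ < a) (hb : r⁻¹ < b) :
    (f ⋆[lsmul ℝ ℝ, μ] dilate (radialBump μ) a) x =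
      (f ⋆[lsmul ℝ ℝ, μ] dilate (radialBump μ) b) x := by
  have hderiv := fun c => hf.hasDerivAt_convolution_dilate_radialBump hfi hr hx (c := c)
  exact isOpen_Ioi.is_const_of_deriv_eq_zero isPreconnected_Ioi
    (fun c hc => (hderiv c hc).differentiableAt.differentiableWithinAt)
    (fun c hc => (hderiv c hc).deriv) ha hb

variable [μ.IsAddHaarMeasure]

theorem IsWeaklyHarmonicOn.harmonicOnNhd_convolution (hf : IsWeaklyHarmonicOn f Ω μ)
    (hfi : LocallyIntegrable f μ) (hφ : ContDiff ℝ ∞ φ) (hφc : HasCompactSupport φ)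
    (hO : IsOpen O) (hOΩ : ∀ x ∈ O, ∀ y ∈ tsupport φ, x - y ∈ Ω) :
    HarmonicOnNhd (f ⋆[lsmul ℝ ℝ, μ] φ) O := fun x hx => by
  have hφ2 : ContDiff ℝ 2 φ := contDiff_infty.1 hφ 2
  refine ⟨(hφc.contDiff_convolution_right (lsmul ℝ ℝ) hfi hφ2).contDiffAt, ?_⟩
  filter_upwards [hO.mem_nhds hx] with y hy
  rw [laplacian_convolution_right _ hfi hφ2 hφc]
  exact hf.convolution_laplacian_eq_zero hφ hφc (hOΩ y hy)

theorem IsWeaklyHarmonicOn.exists_harmonicOnNhd_ball (hf : IsWeaklyHarmonicOn f Ω μ)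
    (hfi : LocallyIntegrable f μ) (hr : 0 < r) (hx : closedBall x (2 * r) ⊆ Ω) :
    ∃ U, HarmonicOnNhd U (ball x r) ∧ f =ᵐ[μ.restrict (ball x r)] U := by
  have hc : r⁻¹ < 2 * r⁻¹ := lt_mul_of_one_lt_left (inv_pos.2 hr) one_lt_two
  have hsub : ∀ y ∈ ball x r, closedBall y r ⊆ Ω := fun y hy =>
    (closedBall_subset_closedBall' (by linarith [mem_ball.1 hy])).trans hx
  have hsupp : Function.support (dilate (radialBump μ) (2 * r⁻¹)) ⊆ closedBall 0 r :=
    (support_dilate_subset support_radialBump_subset ((inv_pos.2 hr).trans hc)).trans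
      (closedBall_subset_closedBall (inv_le_of_inv_le₀ hr hc.le))
  refine ⟨f ⋆[lsmul ℝ ℝ, μ] dilate (radialBump μ) (2 * r⁻¹),
    hf.harmonicOnNhd_convolution hfi
      (contDiff_dilate_radialBump.comp (contDiff_prodMk_right (2 * r⁻¹)))
      (.of_support_subset_isCompact (isCompact_closedBall 0 r) hsupp) isOpen_ball
      fun y hy z hz => hsub y hy ?_, (ae_restrict_iff' measurableSet_ball).2 ?_⟩
  · simpa using closure_minimal hsupp isClosed_closedBall hz
  obtain ⟨M, hM⟩ := hasCompactSupport_radialBump.exists_bound_of_continuous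
    (contDiff_radialBump (μ := μ)).continuous
  filter_upwards [ae_tendsto_convolution_dilate hfi hM support_radialBump_subset
    integral_radialBump] with y hy hyx
  refine tendsto_nhds_unique hy (tendsto_const_nhds.congr' ?_)
  filter_upwards [eventually_gt_atTop r⁻¹] with c hrc
  exact hf.convolution_dilate_radialBump_eq hfi hr (hsub y hyx) hc hrc

theorem exists_harmonicOnNhd_ae_eq_of_locally (hΩ : IsOpen Ω)
    (h : ∀ x ∈ Ω, ∃ U O, IsOpen O ∧ x ∈ O ∧ HarmonicOnNhd U O ∧ f =ᵐ[μ.restrict O] U) :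
    ∃ U, HarmonicOnNhd U Ω ∧ f =ᵐ[μ.restrict Ω] U := by
  choose! U O hO hxO hU hfU using h
  have hUU : ∀ x ∈ Ω, ∀ y ∈ Ω, EqOn (U x) (U y) (O x ∩ O y) := fun x hx y hy =>
    have hxy : ∀ᵐ z ∂μ.restrict (O x ∩ O y), U x z = U y z := by
      filter_upwards [ae_restrict_of_ae_restrict_of_subset inter_subset_left (hfU x hx),
        ae_restrict_of_ae_restrict_of_subset inter_subset_right (hfU y hy)] with z hzx hzy
      exact hzx.symm.trans hzy
    eqOn_open_of_ae_eq hxy ((hO x hx).inter (hO y hy))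
      ((hU x hx).continuousOn.mono inter_subset_left)
      ((hU y hy).continuousOn.mono inter_subset_right)
  have hdiag : ∀ x ∈ Ω, ∀ y ∈ Ω, y ∈ O x → U y y = U x y := fun x hx y hy hyx =>
    hUU y hy x hx ⟨hxO y hy, hyx⟩
  refine ⟨fun y => U y y, fun x hx => ?_, (ae_restrict_iff' hΩ.measurableSet).2 ?_⟩
  · have heq : (fun y => U y y) =ᶠ[𝓝 x] U x := by
      filter_upwards [hΩ.mem_nhds hx, (hO x hx).mem_nhds (hxO x hx)] with y hy hyx
      exact hdiag x hx y hy hyx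
    exact (harmonicAt_congr_nhds heq).2 (hU x hx x (hxO x hx))
  · refine measure_null_of_locally_null _ fun x hx => ?_
    have hxΩ : x ∈ Ω := by_contra fun h => hx fun h' => (h h').elim
    refine ⟨_, inter_mem self_mem_nhdsWithin (mem_nhdsWithin_of_mem_nhds
      ((hO x hxΩ).mem_nhds (hxO x hxΩ))), measure_mono_null ?_
      (ae_imp_of_ae_restrict (hfU x hxΩ))⟩
    rintro y ⟨hy, hyx⟩ hfy
    exact hy fun hyΩ => (hfy hyx).trans (hdiag x hxΩ y hyΩ hyx).symm

theorem IsWeaklyHarmonicOn.exists_harmonicOnNhd (hf : IsWeaklyHarmonicOn f Ω μ) (hΩ : IsOpen Ω)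
    (hfi : LocallyIntegrableOn f Ω μ) :
    ∃ U, HarmonicOnNhd U Ω ∧ f =ᵐ[μ.restrict Ω] U := by
  refine exists_harmonicOnNhd_ae_eq_of_locally hΩ fun x hx => ?_
  obtain ⟨R, hR, hRΩ⟩ := nhds_basis_closedBall.mem_iff.1 (hΩ.mem_nhds hx)
  have hball : MeasurableSet (closedBall x R) := measurableSet_closedBall
  have hint : LocallyIntegrable ((closedBall x R).indicator f) μ :=
    ((integrable_indicator_iff hball).2 (hfi.integrableOn_compact_subset hRΩ
      (isCompact_closedBall x R))).locallyIntegrable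
  obtain ⟨U, hU, hfU⟩ := (hf.indicator hRΩ).exists_harmonicOnNhd_ball hint (half_pos hR)
    (closedBall_subset_closedBall (mul_div_cancel₀ R two_ne_zero).le)
  refine ⟨U, _, isOpen_ball, mem_ball_self (half_pos hR), hU, ?_⟩
  filter_upwards [hfU, ae_restrict_mem measurableSet_ball] with y hy hyR
  rw [← hy, indicator_of_mem]
  exact ball_subset_closedBall (ball_subset_ball (half_le_self hR.le) hyR)

end WeylLemma

end HarmonicExtension

theorem theorem3_general {n : ℕ} [NeZero n] {Ω E : Set (EuclideanSpace ℝ (Fin n))}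
    {u : EuclideanSpace ℝ (Fin n) → ℝ} (hΩ : IsOpen Ω)
    (hE : IsClosed ((fun x : Ω => (x : EuclideanSpace ℝ (Fin n))) ⁻¹' E))
    (hfin : ∀ j : Fin n, ∀ᵐ X : EuclideanSpace ℝ {i : Fin n // i ≠ j},
      (HarmonicExtension.lineSection E j X).Finite)
    (hu : InnerProductSpace.HarmonicOnNhd u (Ω \ E))
    (hu_int : LocallyIntegrableOn u Ω volume)
    (hu_int2 : ∀ j : Fin n, LocallyIntegrableOn
      (HarmonicExtension.partialDeriv j (HarmonicExtension.partialDeriv j u)) Ω volume)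
    (hmatch : ∀ j : Fin n, ∀ᵐ X : EuclideanSpace ℝ {i : Fin n // i ≠ j},
      ∀ t ∈ HarmonicExtension.lineSection E j X, HarmonicExtension.MatchesAt Ω E u j X t) :
    ∃ U : EuclideanSpace ℝ (Fin n) → ℝ,
      InnerProductSpace.HarmonicOnNhd U Ω ∧ EqOn U u (Ω \ E) ∧
      ∀ V : EuclideanSpace ℝ (Fin n) → ℝ,
        InnerProductSpace.HarmonicOnNhd V Ω → EqOn V u (Ω \ E) → EqOn V U Ω := by
  have hΩE : IsOpen (Ω \ E) := by
    simpa only [← preimage_compl, Subtype.image_preimage_coe, sdiff_eq, inf_eq_inter] using!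
      hΩ.isOpenMap_subtype_val _ hE.isOpen_compl
  have hnull : volume (Ω ∩ E) = 0 := by
    refine HarmonicExtension.volume_eq_zero_of_ae_finite_lineSection 0 ?_
      ((hfin 0).mono fun X hX => hX.subset fun t ht => ht.2)
    simpa only [sdiff_sdiff_right_self, inf_eq_inter] using
      hΩ.measurableSet.diff hΩE.measurableSet
  obtain ⟨U, hU, huU⟩ := (HarmonicExtension.isWeaklyHarmonicOn_of_matchesAt hΩ hnull hu hu_int
    hu_int2 hfin hmatch).exists_harmonicOnNhd hΩ hu_int
  refine ⟨U, hU, ?_, fun V hV hVu => Measure.eqOn_open_of_ae_eq (μ := volume) ?_ hΩ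
    hV.continuousOn hU.continuousOn⟩
  · exact (Measure.eqOn_open_of_ae_eq (ae_restrict_of_ae_restrict_of_subset sdiff_subset huU) hΩE
      hu.continuousOn (hU.continuousOn.mono sdiff_subset)).symm
  · filter_upwards [huU, ae_restrict_mem hΩ.measurableSet,
      ae_restrict_of_ae (compl_mem_ae_iff.2 hnull)] with x hx hxΩ hxE
    exact (hVu ⟨hxΩ, fun h => hxE ⟨hxΩ, h⟩⟩).trans hx

theorem theorem3 (n : ℕ) (hn : 2 ≤ n) (Ω E : Set (EuclideanSpace ℝ (Fin n)))
    (hΩ_open : IsOpen Ω) (hΩ_conn : IsConnected Ω)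
    (hE_sub : E ⊆ Ω) (hE_closed : IsClosed ((fun x : Ω => (x : EuclideanSpace ℝ (Fin n))) ⁻¹' E))
    (hE_fin : Measure.hausdorffMeasure ((n : ℝ) - 1) E < ⊤)
    (u : EuclideanSpace ℝ (Fin n) → ℝ)
    (hu : InnerProductSpace.HarmonicOnNhd u (Ω \ E))
    (hu_int : LocallyIntegrableOn u Ω volume)
    (hu_int2 : ∀ j : Fin n, LocallyIntegrableOn
      (HarmonicExtension.partialDeriv j (HarmonicExtension.partialDeriv j u)) Ω volume)
    (hu_match : ∀ j : Fin n,
      ∀ᵐ X : EuclideanSpace ℝ {i : Fin n // i ≠ j} ∂(Measure.hausdorffMeasure ((n : ℝ) - 1)),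
        (HarmonicExtension.lineSection E j X).Finite →
          ∀ t ∈ HarmonicExtension.lineSection E j X, HarmonicExtension.MatchesAt Ω E u j X t) :
    ∃ U : EuclideanSpace ℝ (Fin n) → ℝ,
      InnerProductSpace.HarmonicOnNhd U Ω ∧ EqOn U u (Ω \ E) ∧
      ∀ V : EuclideanSpace ℝ (Fin n) → ℝ,
        InnerProductSpace.HarmonicOnNhd V Ω → EqOn V u (Ω \ E) → EqOn V U Ω := by
  have : NeZero n := ⟨(two_pos.trans_le hn).ne'⟩
  have hd : (0 : ℝ) ≤ n - 1 := sub_nonneg.2 (Nat.one_le_cast.2 (one_le_two.trans hn))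
  have hfin := fun j => HarmonicExtension.ae_finite_lineSection j hd hE_fin
  have hac := HarmonicExtension.volume_absolutelyContinuous_hausdorffMeasure (n := n)
  exact theorem3_general hΩ_open hE_closed (fun j => (hac j).ae_le (hfin j)) hu hu_int hu_int2
    fun j => (hac j).ae_le ((hfin j).mp (hu_match j))
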